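/- Let $V=\bigoplus_{k\ge 0}V_k$ be a vertex operator algebra over $\mathbb{C}$ of CFT-type, that is, $V_k=0$ for $k<0$ and $V_0=\mathbb{C}\mathbf{1}$ with $\mathbf{1}\neq 0$, where $V_k$ is the eigenspace of $L(0)$ with eigenvalue $k$. (Neither simplicity nor holomorphy of $V$ is assumed.) Let $$0\longrightarrow V\xrightarrow{\ \iota\ }\tilde V\xrightarrow{\ \psi\ }V\longrightarrow 0$$ be a short exact sequence of (weak) $V$-modules and $V$-module homomorphisms which does not split, and let $\tilde{\mathbf 1}\in\tilde V$ be an element with $\psi(\tilde{\mathbf 1})=\mathbf 1$ that lies in the generalized eigenspace of $L(0)$ with eigenvalue $0$, that is, $L(0)^m\tilde{\mathbf 1}=0$ for some $m\in\mathbb{N}$. Then $L(-1)\tilde{\mathbf 1}\neq 0$, and there is an element $u\in V_1$ (unique, as $\iota$ is injective) with $\iota(u)=L(-1)\tilde{\mathbf 1}$. Moreover, $u(0)$ maps $V_k$ into itself and acts on $V_k$ as a nilpotent operator for every $k\in\mathbb{Z}$, and $u$ lies in the center of the Lie algebra $V_1$ with bracket $[a,b]=a(0)b$. -/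

import Mathlib

open scoped VertexOperator

/-- The Borcherds identity (the component form of the Jacobi identity) for the vertex operators
`Y` of `V` on itself and the vertex operators `YM` of `V` on `M`. Both sums are finite, because
`Y` and `YM` take values in Laurent series. -/
def BorcherdsIdentity {V M : Type*} [AddCommGroup V] [Module ℂ V] [AddCommGroup M] [Module ℂ M]
    (Y : V →ₗ[ℂ] VertexOperator ℂ V) (YM : V →ₗ[ℂ] VertexOperator ℂ M) : Prop :=
  ∀ (a b : V) (w : M) (l m n : ℤ),
    ∑ᶠ i : ℕ, (Ring.choose m i : ℤ) • ((YM (((Y a)[[l + i]]) b))[[m + n - i]]) w =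
      ∑ᶠ i : ℕ, ((-1 : ℤ) ^ i * Ring.choose l i) •
        (((YM a)[[l + m - i]]) (((YM b)[[n + i]]) w) -
          (l.negOnePow : ℤ) • ((YM b)[[l + n - i]]) (((YM a)[[m + i]]) w))

/-- Vertex algebras over `ℂ`. The condition that `Y(a, z) b` is a Laurent series is built into
`VertexOperator`. -/
structure VertexAlgebra (V : Type*) [AddCommGroup V] [Module ℂ V] where
  /-- the state-field correspondence -/
  Y : V →ₗ[ℂ] VertexOperator ℂ V
  /-- the vacuum -/
  vac : V
  vac_mode : ∀ (n : ℤ) (b : V), ((Y vac)[[n]]) b = if n = -1 then b else 0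
  creation : ∀ a : V, ((Y a)[[-1]]) vac = a
  mode_vac : ∀ (a : V) (n : ℤ), 0 ≤ n → ((Y a)[[n]]) vac = 0
  borcherds : BorcherdsIdentity Y Y

/-- The mode `a_n = a(n)`, the coefficient of `z ^ (-n-1)` in `Y(a, z)`. -/
noncomputable def VertexAlgebra.mode {V : Type*} [AddCommGroup V] [Module ℂ V]
    (X : VertexAlgebra V) (a : V) (n : ℤ) : Module.End ℂ V := (X.Y a)[[n]]

/-- Vertex operator algebras over `ℂ`. The Virasoro operators are `L(n) = ω_{n+1}`, and the grading
is the one by the eigenvalues of `L(0)`. -/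
structure VertexOperatorAlgebra (V : Type*) [AddCommGroup V] [Module ℂ V] extends
    VertexAlgebra V where
  /-- the conformal vector -/
  conf : V
  /-- the central charge -/
  charge : ℂ
  virasoro : ∀ (m n : ℤ) (v : V),
    toVertexAlgebra.mode conf (m + 1) (toVertexAlgebra.mode conf (n + 1) v) -
        toVertexAlgebra.mode conf (n + 1) (toVertexAlgebra.mode conf (m + 1) v) =
      ((m : ℂ) - n) • toVertexAlgebra.mode conf (m + n + 1) v +
        (if m + n = 0 then ((m : ℂ) ^ 3 - m) / 12 * charge else 0) • v
  translation : ∀ (a : V) (n : ℤ),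
    toVertexAlgebra.mode (toVertexAlgebra.mode conf 0 a) n =
      (-(n : ℂ)) • toVertexAlgebra.mode a (n - 1)
  grading : DirectSum.IsInternal
    fun k : ℤ => Module.End.eigenspace (toVertexAlgebra.mode conf 1) (k : ℂ)
  finite_dim : ∀ k : ℤ,
    Module.Finite ℂ (Module.End.eigenspace (toVertexAlgebra.mode conf 1) (k : ℂ))
  bounded_below : ∃ N : ℤ, ∀ k < N,
    Module.End.eigenspace (toVertexAlgebra.mode conf 1) (k : ℂ) = ⊥

namespace VertexOperatorAlgebra

/-- The operator `L(n)` on `V`. -/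
noncomputable def L {V : Type*} [AddCommGroup V] [Module ℂ V] (X : VertexOperatorAlgebra V)
    (n : ℤ) : Module.End ℂ V := X.mode X.conf (n + 1)

/-- The homogeneous subspace `V_k`, the eigenspace of `L(0)` with eigenvalue `k`. -/
noncomputable def weightSpace {V : Type*} [AddCommGroup V] [Module ℂ V]
    (X : VertexOperatorAlgebra V) (k : ℤ) : Submodule ℂ V :=
  Module.End.eigenspace (X.L 0) (k : ℂ)

/-- `V` is of CFT-type: `V_k = 0` for `k < 0`, and `V_0 = ℂ 𝟏` is one-dimensional. -/
structure IsCFTType {V : Type*} [AddCommGroup V] [Module ℂ V] (X : VertexOperatorAlgebra V) :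
    Prop where
  vac_ne_zero : X.vac ≠ 0
  weight_neg : ∀ k : ℤ, k < 0 → X.weightSpace k = ⊥
  weight_zero : X.weightSpace 0 = Submodule.span ℂ {X.vac}

/-- (Weak) modules over a vertex operator algebra: no grading and no semisimplicity of `L(0)` is
required. -/
structure WeakModule {V : Type*} [AddCommGroup V] [Module ℂ V] (X : VertexOperatorAlgebra V)
    (M : Type*) [AddCommGroup M] [Module ℂ M] where
  /-- the action of `V` on `M` by vertex operators -/
  Y : V →ₗ[ℂ] VertexOperator ℂ M
  vac_mode : ∀ (n : ℤ) (w : M), ((Y X.vac)[[n]]) w = if n = -1 then w else 0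
  borcherds : BorcherdsIdentity X.Y Y

/-- The mode `a_n` acting on a module. -/
noncomputable def WeakModule.mode {V : Type*} [AddCommGroup V] [Module ℂ V]
    {X : VertexOperatorAlgebra V} {M : Type*} [AddCommGroup M] [Module ℂ M]
    (N : X.WeakModule M) (a : V) (n : ℤ) : Module.End ℂ M := (N.Y a)[[n]]

/-- The operator `L(n)` acting on a module. -/
noncomputable def WeakModule.L {V : Type*} [AddCommGroup V] [Module ℂ V]
    {X : VertexOperatorAlgebra V} {M : Type*} [AddCommGroup M] [Module ℂ M]
    (N : X.WeakModule M) (n : ℤ) : Module.End ℂ M := N.mode X.conf (n + 1)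

/-- `V` as a module over itself. -/
def adjoint {V : Type*} [AddCommGroup V] [Module ℂ V] (X : VertexOperatorAlgebra V) :
    X.WeakModule V where
  Y := X.Y
  vac_mode := X.vac_mode
  borcherds := X.borcherds

/-- Homomorphisms of modules over a vertex operator algebra. -/
structure WeakModule.Hom {V : Type*} [AddCommGroup V] [Module ℂ V]
    {X : VertexOperatorAlgebra V} {M M' : Type*} [AddCommGroup M] [Module ℂ M]
    [AddCommGroup M'] [Module ℂ M'] (N : X.WeakModule M) (N' : X.WeakModule M') extends
    M →ₗ[ℂ] M' where
  map_mode : ∀ (a : V) (n : ℤ) (w : M), toFun (N.mode a n w) = N'.mode a n (toFun w)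

section Lemmas

variable {V : Type*} [AddCommGroup V] [Module ℂ V] (X : VertexOperatorAlgebra V)

theorem borcherds_mode (a b w : V) (l m n : ℤ) :
    ∑ᶠ i : ℕ, (Ring.choose m i : ℤ) • X.mode (X.mode a (l + i) b) (m + n - i) w =
      ∑ᶠ i : ℕ, ((-1 : ℤ) ^ i * Ring.choose l i) •
        (X.mode a (l + m - i) (X.mode b (n + i) w) -
          (l.negOnePow : ℤ) • X.mode b (l + n - i) (X.mode a (m + i) w)) :=
  X.borcherds a b w l m n

theorem mode_zero_left (n : ℤ) : X.mode 0 n = 0 := by simp [VertexAlgebra.mode]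

theorem mode_add_left (a b : V) (n : ℤ) : X.mode (a + b) n = X.mode a n + X.mode b n := by
  simp [VertexAlgebra.mode]

theorem mode_smul_left (c : ℂ) (a : V) (n : ℤ) : X.mode (c • a) n = c • X.mode a n := by
  simp [VertexAlgebra.mode]

/-- The right-hand side of the Borcherds identity for `l = 0`. -/
theorem borcherds_zero (a b w : V) (m n : ℤ) :
    ∑ᶠ i : ℕ, (Ring.choose m i : ℤ) • X.mode (X.mode a i b) (m + n - i) w =
      X.mode a m (X.mode b n w) - X.mode b n (X.mode a m w) := by
  have h := X.borcherds_mode a b w 0 m n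
  rw [finsum_eq_single (fun i : ℕ => ((-1 : ℤ) ^ i * Ring.choose (0 : ℤ) i) • _) 0] at h
  · simpa using h
  · intro i hi
    obtain ⟨j, rfl⟩ := Nat.exists_eq_succ_of_ne_zero hi
    simp [Ring.choose_zero_succ]

/-- `[a_0, b_0] = (a_0 b)_0`. -/
theorem commutator_zero (a b w : V) :
    X.mode (X.mode a 0 b) 0 w = X.mode a 0 (X.mode b 0 w) - X.mode b 0 (X.mode a 0 w) := by
  rw [← X.borcherds_zero a b w 0 0, finsum_eq_single _ 0]
  · simp
  · intro i hi
    obtain ⟨j, rfl⟩ := Nat.exists_eq_succ_of_ne_zero hi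
    simp [Ring.choose_zero_succ]

theorem mem_weightSpace {k : ℤ} {v : V} : v ∈ X.weightSpace k ↔ X.mode X.conf 1 v = (k : ℂ) • v := by
  simp [weightSpace, L]

theorem mode_mem_weightSpace {p q r n : ℤ} (hr : r = p + q - n - 1) {a b : V}
    (ha : a ∈ X.weightSpace p) (hb : b ∈ X.weightSpace q) : X.mode a n b ∈ X.weightSpace r := by
  rw [mem_weightSpace] at *
  have h := X.borcherds_zero X.conf a b 1 n
  rw [finsum_eq_sum_of_support_subset (s := Finset.range 2)] at h
  · simp only [Finset.sum_range_succ, Finset.sum_range_zero, Nat.cast_zero, Nat.cast_one,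
      Ring.choose_zero_right, Ring.choose_one_right, ha, hb, X.translation, X.mode_smul_left,
      one_smul, zero_add, LinearMap.smul_apply, map_smul] at h
    have e1 : (1 + n - 0 - 1 : ℤ) = n := by ring
    have e2 : (1 + n - 1 : ℤ) = n := by ring
    rw [e1, e2, eq_sub_iff_add_eq] at h
    rw [← h, ← add_smul, ← add_smul, hr]
    congr 1
    push_cast
    ring
  · intro i hi
    by_contra hn
    simp only [Finset.coe_range, Set.mem_Iio, not_lt] at hn
    apply hi
    have : Ring.choose (1 : ℤ) i = 0 := by
      have := Ring.choose_natCast (R := ℤ) 1 i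
      rw [Nat.cast_one] at this
      rw [this, Nat.choose_eq_zero_of_lt (by omega)]
      rfl
    simp [this]

theorem IsCFTType.mode_zero_skew {X : VertexOperatorAlgebra V} (h : X.IsCFTType) {a b : V}
    (ha : a ∈ X.weightSpace 1) (hb : b ∈ X.weightSpace 1) :
    X.mode a 0 b = -X.mode b 0 a := by
  have h1 := X.borcherds_zero a b X.vac (-1) 0
  rw [finsum_eq_single _ 0] at h1
  · have e1 : X.mode b 0 X.vac = 0 := X.mode_vac b 0 le_rfl
    have e2 : X.mode a (-1) X.vac = a := X.creation a
    have e3 : X.mode (X.mode a 0 b) (-1) X.vac = X.mode a 0 b := X.creation _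
    simpa [e1, e2, e3] using h1
  · intro i hi
    have hw : X.mode a i b ∈ X.weightSpace (1 - i) :=
      X.mode_mem_weightSpace (by ring) ha hb
    have : X.mode (X.mode a i b) (-1 + 0 - i) X.vac = 0 := by
      rcases Nat.lt_or_ge 1 i with h2 | h2
      · rw [h.weight_neg _ (by omega), Submodule.mem_bot] at hw
        rw [hw, X.mode_zero_left]
        rfl
      · obtain rfl : i = 1 := by omega
        rw [show (1 - ((1 : ℕ) : ℤ)) = 0 by simp, h.weight_zero,
          Submodule.mem_span_singleton] at hw
        obtain ⟨c, hc⟩ := hw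
        have e : X.mode X.vac (-1 + 0 - (1 : ℕ)) X.vac = 0 :=
          (X.vac_mode _ _).trans (if_neg (by norm_num))
        rw [← hc, X.mode_smul_left, LinearMap.smul_apply, e, smul_zero]
    rw [this, smul_zero]

end Lemmas

section LieAlgebra

variable {V : Type*} [AddCommGroup V] [Module ℂ V] {X : VertexOperatorAlgebra V}

/-- The weight one subspace `V_1` of a vertex operator algebra of CFT-type, on which
`[a, b] = a_0 b` is a Lie bracket. -/
noncomputable def IsCFTType.weightOne (_h : X.IsCFTType) : Submodule ℂ V := X.weightSpace 1

noncomputable instance IsCFTType.instLieRing (h : X.IsCFTType) : LieRing h.weightOne where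
  toAddCommGroup := h.weightOne.addCommGroup
  bracket a b := ⟨X.mode a 0 b, X.mode_mem_weightSpace (by norm_num) a.2 b.2⟩
  add_lie a b c := Subtype.ext (by simp [X.mode_add_left])
  lie_add a b c := Subtype.ext (by simp)
  lie_self a := Subtype.ext (by
    have h1 := h.mode_zero_skew a.2 a.2
    have h2 : (2 : ℂ) • X.mode (a : V) 0 a = 0 := by
      rw [two_smul]
      nth_rewrite 1 [h1]
      exact neg_add_cancel _
    exact (smul_eq_zero.mp h2).resolve_left two_ne_zero)
  leibniz_lie a b c := Subtype.ext (by
    have := X.commutator_zero a b c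
    simp only [Submodule.coe_add, this]
    abel)

noncomputable instance IsCFTType.instLieAlgebra (h : X.IsCFTType) : LieAlgebra ℂ h.weightOne where
  toModule := h.weightOne.module
  lie_smul c a b := Subtype.ext (map_smul (X.mode (a : V) 0) c (b : V))

end LieAlgebra

end VertexOperatorAlgebra

/-! If `L(-1) t = 0`, then `t` is vacuum-like and `v ↦ v_{-1} t` splits the sequence. In general
`L(-1) t = ι u`, since `ψ` sends it to `L(-1) 𝟏 = 0`.

The claims on `u(0)` follow from the stronger fact that `u(0) = 0` on all of `V`. For `i ≥ 0`, `ψ`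
kills `a_i t`, so `a_i t = ι (f_i)`, and `[L(-1), a_i] = -i a_{i-1}` gives `a_i u = L(-1) f_i + i
f_{i-1}`. Skew-symmetry writes `-u_0 a` as an alternating sum of `L(-1)^i (a_i u) / i!`, which
telescopes to zero (`mode_zero_eq_zero_of_descent`). Centrality then follows from antisymmetry of
the bracket on `V_1`. -/

namespace VertexOperatorAlgebra

/-! ### Modes and `L(-1)` on weak modules -/

section WeakModule

variable {V : Type*} [AddCommGroup V] [Module ℂ V] {X : VertexOperatorAlgebra V}
  {M : Type*} [AddCommGroup M] [Module ℂ M] (N : X.WeakModule M)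

theorem WeakModule.borcherds_mode (a b : V) (w : M) (l m n : ℤ) :
    ∑ᶠ i : ℕ, (Ring.choose m i : ℤ) • N.mode (X.mode a (l + i) b) (m + n - i) w =
      ∑ᶠ i : ℕ, ((-1 : ℤ) ^ i * Ring.choose l i) •
        (N.mode a (l + m - i) (N.mode b (n + i) w) -
          (l.negOnePow : ℤ) • N.mode b (l + n - i) (N.mode a (m + i) w)) :=
  N.borcherds a b w l m n

theorem WeakModule.mode_zero_left (n : ℤ) : N.mode 0 n = 0 := by simp [WeakModule.mode]

theorem WeakModule.mode_add_left (a b : V) (n : ℤ) :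
    N.mode (a + b) n = N.mode a n + N.mode b n := by
  simp [WeakModule.mode]

theorem WeakModule.mode_smul_left (c : ℂ) (a : V) (n : ℤ) :
    N.mode (c • a) n = c • N.mode a n := by
  simp [WeakModule.mode]

theorem WeakModule.exists_mode_eq_zero (a : V) (w : M) :
    ∃ k : ℕ, ∀ n : ℤ, (k : ℤ) ≤ n → N.mode a n w = 0 := by
  -- `a_n w` is the coefficient of `z ^ (-n-1)`, so it vanishes once `-n-1` is below the order.
  refine ⟨(-HahnSeries.order ((HahnModule.of ℂ).symm (N.Y a w))).toNat, fun n hn => ?_⟩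
  have h := Int.self_le_toNat (-HahnSeries.order ((HahnModule.of ℂ).symm (N.Y a w)))
  exact VertexOperator.ncoeff_eq_zero_of_lt_order _ _ _ (by omega)

/-- `[a_0, b_n] = (a_0 b)_n` on a module. -/
theorem WeakModule.commutator_zero (a b : V) (n : ℤ) (w : M) :
    N.mode (X.mode a 0 b) n w = N.mode a 0 (N.mode b n w) - N.mode b n (N.mode a 0 w) := by
  have h := N.borcherds_mode a b w 0 0 n
  rw [finsum_eq_single _ 0, finsum_eq_single _ 0] at h
  · simpa using h
  all_goals
    intro i hi
    obtain ⟨j, rfl⟩ := Nat.exists_eq_succ_of_ne_zero hi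
    simp [Ring.choose_zero_succ]

theorem conf_mode_zero (X : VertexOperatorAlgebra V) (a : V) :
    X.mode X.conf 0 a = X.mode a (-2) X.vac := by
  have h := congrArg (fun f : Module.End ℂ V => f X.vac) (X.translation a (-1))
  have e : X.mode (X.mode X.conf 0 a) (-1) X.vac = X.mode X.conf 0 a := X.creation _
  simpa [e] using h

theorem WeakModule.translation (a : V) (n : ℤ) (w : M) :
    N.mode (X.mode X.conf 0 a) n w = (-(n : ℂ)) • N.mode a (n - 1) w := by
  have hv : ∀ (k : ℤ) (w : M), k ≠ -1 → N.mode X.vac k w = 0 := fun k w hk =>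
    (N.vac_mode k w).trans (if_neg hk)
  -- The right side involves only the vacuum modes `i` and `-2 - i`, never `-1`, so it vanishes. The
  -- left side keeps `(a_{-2} 𝟏)_n w + n a_{n-1} w`.
  have h := N.borcherds_mode a X.vac w (-2) n 0
  have hr : ∀ i : ℕ, ((-1 : ℤ) ^ i * Ring.choose (-2 : ℤ) i) •
        (N.mode a (-2 + n - i) (N.mode X.vac (0 + i) w) -
          ((-2 : ℤ).negOnePow : ℤ) • N.mode X.vac (-2 + 0 - i) (N.mode a (n + i) w)) = 0 := by
    intro i
    rw [hv _ _ (by omega), hv _ _ (by omega)]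
    simp
  simp only [hr, finsum_zero] at h
  have e : X.mode a (-1) X.vac = a := X.creation a
  rw [finsum_eq_sum_of_support_subset (s := Finset.range 2)] at h
  · simp only [Finset.sum_range_succ, Finset.sum_range_zero, Nat.cast_zero, Nat.cast_one,
      Ring.choose_zero_right, Ring.choose_one_right, one_smul, zero_add, add_zero, sub_zero,
      show (-2 + 1 : ℤ) = -1 by norm_num, e] at h
    rw [conf_mode_zero, eq_neg_of_add_eq_zero_left h, neg_smul, Int.cast_smul_eq_zsmul]
  · intro i hi
    by_contra hn
    simp only [Finset.coe_range, Set.mem_Iio, not_lt] at hn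
    apply hi
    have : X.mode a (-2 + i) X.vac = 0 := X.mode_vac a _ (by omega)
    simp only [this, N.mode_zero_left, LinearMap.zero_apply, smul_zero]

/-- `[L(-1), a_n] = -n a_{n-1}` on a module. -/
theorem WeakModule.L_neg_one_mode (a : V) (n : ℤ) (w : M) :
    N.mode a n (N.L (-1) w) = N.L (-1) (N.mode a n w) + (n : ℂ) • N.mode a (n - 1) w := by
  have h := N.commutator_zero X.conf a n w
  rw [N.translation] at h
  change N.mode a n (N.mode X.conf 0 w) = N.mode X.conf 0 (N.mode a n w) + _
  rw [neg_smul] at h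
  rw [neg_eq_iff_eq_neg.mp h]
  abel

/-! ### Vacuum-like vectors -/

/-- A vector killed by `L(-1)` is vacuum-like. -/
theorem WeakModule.mode_eq_zero_of_L_neg_one {w : M} (hw : N.L (-1) w = 0) (a : V) (n : ℕ) :
    N.mode a n w = 0 := by
  obtain ⟨k, hk⟩ := N.exists_mode_eq_zero a w
  -- Descend from large modes: `a_{j+1} w = 0` forces `(j+1) a_j w = 0`.
  refine Nat.decreasingInduction' (m := n) (n := n + k)
    (P := fun j => N.mode a j w = 0) (fun j _ _ hj => ?_) (by omega) (hk _ (by omega))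
  have h := N.L_neg_one_mode a ((j + 1 : ℕ) : ℤ) w
  rw [hw, hj, map_zero, map_zero, zero_add] at h
  have h2 := (smul_eq_zero.mp h.symm).resolve_left (by exact_mod_cast j.succ_ne_zero)
  simpa using h2

theorem WeakModule.mode_mode_of_L_neg_one {w : M} (hw : N.L (-1) w = 0) (a b : V) (n : ℤ) :
    N.mode (X.mode a n b) (-1) w = N.mode a n (N.mode b (-1) w) := by
  have h0 := N.mode_eq_zero_of_L_neg_one hw
  -- On the right, only `i = 0` survives because nonnegative modes kill `w`.
  have h := N.borcherds_mode a b w n 0 (-1)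
  rw [finsum_eq_single _ 0, finsum_eq_single _ 0] at h
  · simpa [show N.mode a 0 w = 0 from h0 a 0] using h
  · intro i hi
    obtain ⟨j, rfl⟩ := Nat.exists_eq_succ_of_ne_zero hi
    have e1 : N.mode b (-1 + (j.succ : ℕ)) w = 0 := by
      rw [show (-1 + (j.succ : ℕ) : ℤ) = j by push_cast; ring]
      exact h0 b j
    have e2 : N.mode a (0 + (j.succ : ℕ)) w = 0 := by
      rw [zero_add]
      exact h0 a _
    simp only [e1, e2, map_zero, smul_zero, sub_zero]
  · intro i hi
    obtain ⟨j, rfl⟩ := Nat.exists_eq_succ_of_ne_zero hi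
    simp [Ring.choose_zero_succ]

/-- The homomorphism `v ↦ v_{-1} w` from `V` attached to a vector `w` killed by `L(-1)`. -/
noncomputable def WeakModule.homOfVacuumLike {w : M} (hw : N.L (-1) w = 0) : X.adjoint.Hom N where
  toFun v := N.mode v (-1) w
  map_add' a b := by rw [N.mode_add_left, LinearMap.add_apply]
  map_smul' c a := by rw [N.mode_smul_left, LinearMap.smul_apply, RingHom.id_apply]
  map_mode a n b := N.mode_mode_of_L_neg_one hw a b n

theorem WeakModule.L_zero_L_neg_one (w : M) :
    N.L 0 (N.L (-1) w) = N.L (-1) (N.L 0 w) + N.L (-1) w := by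
  have h := N.L_neg_one_mode X.conf 1 w
  rwa [Int.cast_one, one_smul] at h

/-! ### Skew-symmetry and the telescoping sum -/

theorem ringChoose_neg_one (i : ℕ) : Ring.choose (-1 : ℤ) i = (-1) ^ i := by
  induction i with
  | zero => simp
  | succ i ih =>
    have h := Ring.choose_succ_succ (-1 : ℤ) i
    rw [neg_add_cancel, Ring.choose_zero_succ, ih] at h
    rw [pow_succ]
    linarith

/-- Skew-symmetry at mode zero, with `c_{-1-i} 𝟏` standing for `L(-1)^i c / i!`. -/
theorem neg_mode_zero_eq_finsum (X : VertexOperatorAlgebra V) (a b : V) :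
    -X.mode b 0 a = ∑ᶠ i : ℕ, ((-1 : ℤ) ^ i) • X.mode (X.mode a i b) (-1 - i) X.vac := by
  have h := X.borcherds_zero a b X.vac (-1) 0
  have e1 : X.mode b 0 X.vac = 0 := X.mode_vac b 0 le_rfl
  have e2 : X.mode a (-1) X.vac = a := X.creation a
  simpa [e1, e2, ringChoose_neg_one] using h.symm

/-- If `a_i b = L(-1) f_i + i f_{i-1}` for all `i ≥ 0`, where `f_i = 0` for large `i`, then
`b_0 a = 0`. -/
theorem mode_zero_eq_zero_of_descent (X : VertexOperatorAlgebra V) {a b : V} (f : ℕ → V) {k : ℕ}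
    (hk : ∀ i, k ≤ i → f i = 0) (h0 : X.mode a 0 b = X.mode X.conf 0 (f 0))
    (hf : ∀ i : ℕ, X.mode a (i + 1 : ℕ) b =
      X.mode X.conf 0 (f (i + 1)) + ((i + 1 : ℕ) : ℂ) • f i) :
    X.mode b 0 a = 0 := by
  -- The `i f_{i-1}` part of each term cancels the `L(-1) f_{i-1}` part of the preceding one,
  -- leaving one boundary term in `f n`.
  have hsum : ∀ n : ℕ,
      ∑ i ∈ Finset.range (n + 1), ((-1 : ℤ) ^ i) • X.mode (X.mode a i b) (-1 - i) X.vac =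
        ((-1 : ℤ) ^ n) • ((n + 1 : ℂ) • X.mode (f n) (-2 - n) X.vac) := by
    intro n
    induction n with
    | zero => simp [h0, X.translation]
    | succ n ih =>
      rw [Finset.sum_range_succ, ih, hf, X.mode_add_left, X.translation, X.mode_smul_left]
      simp only [LinearMap.add_apply, LinearMap.smul_apply, smul_add, pow_succ, mul_neg, mul_one,
        neg_smul]
      rw [show (-1 - ((n + 1 : ℕ) : ℤ)) = -2 - n by push_cast; ring,
        show (-2 - ((n + 1 : ℕ) : ℤ)) = -2 - n - 1 by push_cast; ring]
      push_cast
      simp only [← neg_smul]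
      rw [show (-(-2 - (n : ℂ))) = n + 1 + 1 by ring]
      simp only [neg_smul]
      abel
  rw [← neg_eq_zero, neg_mode_zero_eq_finsum, finsum_eq_sum_of_support_subset
    (s := Finset.range (k + 1)), hsum, hk k le_rfl, X.mode_zero_left]
  · simp
  · intro i hi
    by_contra hn
    simp only [Finset.coe_range, Set.mem_Iio, not_lt] at hn
    apply hi
    obtain ⟨j, rfl⟩ : ∃ j, i = j + 1 := ⟨i - 1, by omega⟩
    have : X.mode a ((j + 1 : ℕ) : ℤ) b = 0 := by
      rw [hf, hk _ (by omega), hk _ (by omega), map_zero, smul_zero, add_zero]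
    simp only [this, X.mode_zero_left, LinearMap.zero_apply, smul_zero]

/-- `L(0)` acts semisimply on `V`. -/
theorem weightSpace_eq_maxGenEigenspace (X : VertexOperatorAlgebra V) (k : ℤ) :
    (X.L 0).maxGenEigenspace (k : ℂ) = X.weightSpace k := by
  refine le_antisymm (fun w hw => ?_) ((Module.End.genEigenspace (X.L 0) _).monotone (by simp))
  have htop : ⨆ j : ℤ, X.weightSpace j = ⊤ := X.grading.submodule_iSup_eq_top
  -- Split `w` into its part in `V_k` and the rest; the rest vanishes by independence of generalized
  -- eigenspaces.
  have hle : ⨆ j : ℤ, X.weightSpace j ≤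
      X.weightSpace k ⊔ ⨆ μ ≠ (k : ℂ), (X.L 0).maxGenEigenspace μ := by
    refine iSup_le fun j => ?_
    by_cases hj : j = k
    · rw [hj]
      exact le_sup_left
    · refine le_sup_of_le_right (le_iSup₂_of_le (j : ℂ) (by exact_mod_cast hj) ?_)
      exact (Module.End.genEigenspace (X.L 0) _).monotone (by simp)
  obtain ⟨x, hx, y, hy, rfl⟩ := Submodule.mem_sup.mp (hle (htop ▸ Submodule.mem_top : w ∈ _))
  have hx' : x ∈ (X.L 0).maxGenEigenspace (k : ℂ) :=
    (Module.End.genEigenspace (X.L 0) _).monotone (by simp) hx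
  have hy' := (Submodule.add_mem_iff_right _ hx').mp hw
  have := (Submodule.disjoint_def.mp ((X.L 0).independent_maxGenEigenspace (k : ℂ))) y hy' hy
  rwa [this, add_zero]

end WeakModule

end VertexOperatorAlgebra

/-! ### The extension of `V` by itself -/

theorem VertexOperatorAlgebra.mode_zero_eq_zero_of_extension
    {V : Type*} [AddCommGroup V] [Module ℂ V] {X : VertexOperatorAlgebra V}
    {E : Type*} [AddCommGroup E] [Module ℂ E] {N : X.WeakModule E}
    {ι : X.adjoint.Hom N} {ψ : N.Hom X.adjoint}
    (hι : Function.Injective ι.toLinearMap)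
    (hexact : Function.Exact ι.toLinearMap ψ.toLinearMap)
    {t : E} (htψ : ψ.toLinearMap t = X.vac) {u : V} (hu : ι.toLinearMap u = N.L (-1) t) (a : V) :
    X.mode u 0 a = 0 := by
  have hmode : ∀ (a : V) (n : ℤ) (v : V),
      ι.toLinearMap (X.mode a n v) = N.mode a n (ι.toLinearMap v) := ι.map_mode
  have hex : ∀ n : ℕ, ∃ f : V, ι.toLinearMap f = N.mode a n t := fun n => by
    refine (hexact _).mp ((ψ.map_mode a n t).trans ?_)
    change X.mode a n (ψ.toLinearMap t) = 0
    rw [htψ]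
    exact X.mode_vac a n (Int.natCast_nonneg n)
  choose f hf using hex
  obtain ⟨k, hk⟩ := N.exists_mode_eq_zero a t
  refine X.mode_zero_eq_zero_of_descent f (k := k) (fun i hi => hι ?_) (hι ?_) fun i => hι ?_
  · rw [hf, hk _ (by omega), map_zero]
  · have h := N.L_neg_one_mode a 0 t
    rw [Int.cast_zero, zero_smul, add_zero] at h
    rw [hmode, hmode, hu, h, hf]
    rfl
  · have h := N.L_neg_one_mode a ((i + 1 : ℕ) : ℤ) t
    rw [show (((i + 1 : ℕ) : ℤ) - 1) = i by push_cast; ring] at h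
    rw [hmode, map_add, hmode, map_smul, hu, h, hf, hf]
    rfl

theorem proposition1 {V : Type*} [AddCommGroup V] [Module ℂ V]
    (X : VertexOperatorAlgebra V) (hX : X.IsCFTType)
    {E : Type*} [AddCommGroup E] [Module ℂ E] (N : X.WeakModule E)
    (ι : X.adjoint.Hom N) (ψ : N.Hom X.adjoint)
    (hι : Function.Injective ι.toLinearMap)
    (hexact : Function.Exact ι.toLinearMap ψ.toLinearMap)
    (hψ : Function.Surjective ψ.toLinearMap)
    (hnonsplit : ¬ ∃ σ : X.adjoint.Hom N, ∀ v : V, ψ.toLinearMap (σ.toLinearMap v) = v)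
    (t : E) (ht : t ∈ Module.End.maxGenEigenspace (N.L 0) 0)
    (htψ : ψ.toLinearMap t = X.vac) :
    N.L (-1) t ≠ 0 ∧
      ∃ u : hX.weightOne,
        ι.toLinearMap (u : V) = N.L (-1) t ∧
        (∀ k : ℤ, ∃ hk : ∀ v ∈ X.weightSpace k, X.mode (u : V) 0 v ∈ X.weightSpace k,
          IsNilpotent ((X.mode (u : V) 0).restrict hk)) ∧
        u ∈ LieAlgebra.center ℂ hX.weightOne := by
  have hψmode : ∀ (a : V) (n : ℤ) (w : E),
      ψ.toLinearMap (N.mode a n w) = X.mode a n (ψ.toLinearMap w) := ψ.map_mode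
  have hιL : ∀ (n : ℤ) (v : V), ι.toLinearMap (X.L n v) = N.L n (ι.toLinearMap v) := fun n v =>
    ι.map_mode X.conf (n + 1) v
  have hLvac : ∀ n : ℤ, -1 ≤ n → X.L n X.vac = 0 := fun n hn =>
    X.mode_vac X.conf (n + 1) (by omega)
  have hψL : ∀ n : ℤ, -1 ≤ n → ψ.toLinearMap (N.L n t) = 0 := fun n hn => by
    rw [← hLvac n hn, ← htψ]
    exact hψmode X.conf (n + 1) t
  refine ⟨fun h => hnonsplit ⟨N.homOfVacuumLike h, fun v => ?_⟩, ?_⟩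
  · refine (hψmode v (-1) t).trans ?_
    rw [htψ]
    exact X.creation v
  obtain ⟨u, hu⟩ := (hexact _).mp (hψL (-1) le_rfl)
  obtain ⟨c, hc⟩ := (hexact _).mp (hψL 0 (by norm_num))
  have hιpow : ∀ (m : ℕ) (v : V),
      ι.toLinearMap ((X.L 0 ^ m) v) = (N.L 0 ^ m) (ι.toLinearMap v) := by
    intro m
    induction m with
    | zero => simp
    | succ m ih => intro v; rw [pow_succ, pow_succ, Module.End.mul_apply, ih, hιL]; rfl
  -- `L(0) t = ι c` is again a generalized null vector of `L(0)`, hence so is `c`, and `L(0)` is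
  -- semisimple on `V`. Thus `c` is a multiple of `𝟏` and `L(-1) c = 0`, which puts `u` in weight
  -- one.
  have hc0 : c ∈ X.weightSpace 0 := by
    rw [← X.weightSpace_eq_maxGenEigenspace]
    obtain ⟨m, hm⟩ := (Module.End.mem_maxGenEigenspace _ _ _).mp ht
    refine (Module.End.mem_maxGenEigenspace _ _ _).mpr ⟨m, hι ?_⟩
    rw [zero_smul, sub_zero] at hm
    rw [Int.cast_zero, zero_smul, sub_zero, hιpow, hc, ← Module.End.mul_apply, ← pow_succ, pow_succ',
      Module.End.mul_apply, hm, map_zero, map_zero]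
  have hLc : X.L (-1) c = 0 := by
    rw [hX.weight_zero, Submodule.mem_span_singleton] at hc0
    obtain ⟨r, rfl⟩ := hc0
    rw [map_smul, hLvac _ le_rfl, smul_zero]
  have hu1 : u ∈ X.weightSpace 1 := by
    refine Module.End.mem_eigenspace_iff.mpr (hι ?_)
    rw [hιL, hu, N.L_zero_L_neg_one, ← hc, ← hιL, hLc, map_zero, zero_add, Int.cast_one, one_smul,
      hu]
  have hu0 := VertexOperatorAlgebra.mode_zero_eq_zero_of_extension hι hexact htψ hu
  refine ⟨⟨u, hu1⟩, hu, fun k => ⟨fun v _ => ?_, 1, ?_⟩, ?_⟩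
  · rw [hu0]
    exact zero_mem _
  · ext v
    rw [pow_one]
    exact hu0 v
  · rw [LieModule.mem_maxTrivSubmodule]
    intro x
    refine Subtype.ext ((hX.mode_zero_skew x.2 hu1).trans ?_)
    rw [hu0, neg_zero]
    rfl
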